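/- Let $X$ be a real reflexive Banach space with dual $X^*$, pairing $\langle x,\xi\rangle=\xi(x)$, and identify $X^{**}=X$. For $f:X\to(-\infty,+\infty]$ let $\operatorname{dom} f=\{f<+\infty\}$, $\partial f(x)=\{\xi\in X^*: f(y)\ge f(x)+\langle y-x,\xi\rangle\ \forall y\in X\}$, $\operatorname{dom}\partial f=\{x:\partial f(x)\neq\emptyset\}$ and $f^*(\xi)=\sup_{x\in X}\langle x,\xi\rangle-f(x)$. Let $\Gamma$ be the set of convex lower semicontinuous $\gamma:[0,\infty)\to[0,\infty]$ with $\gamma(0)=0$, $\Gamma_U=\{\gamma\in\Gamma:\gamma(r)>0\text{ for }r>0\}$, $\Gamma_L=\{\gamma\in\Gamma:\gamma(r)/r\to0\text{ as }r\to0\}$, and $\gamma^*(s)=\sup_{r\ge0}(rs-\gamma(r))$ for $s\ge0$. Let $f:X\to(-\infty,+\infty]$ be proper, convex, lower semicontinuous and uniformly essentially strongly convex with modulus $\gamma\in\Gamma_U$, that is: (a) $f$ is strictly convex on every convex subset of $\operatorname{dom}\partial f$; (b) $(\partial f)^{-1}$ is locally bounded on its domain; (c) for every $x_0\in\operatorname{dom}\partial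 f$ there is $\xi_0\in X^*$ with $$f(x)\ge f(x_0)+\langle x-x_0,\xi_0\rangle+\gamma(\|x-x_0\|)\quad\forall x\in X.\qquad(1)$$ (i) Then $f^*$ is proper and essentially Fréchet differentiable: it is proper, convex and lower semicontinuous, $\operatorname{int}\operatorname{dom}f^*\ne\emptyset$, $f^*$ is Fréchet differentiable on $\operatorname{int}\operatorname{dom}f^*$, and $\|Df^*(\xi_j)\|\to\infty$ for every sequence $(\xi_j)$ in $\operatorname{int}\operatorname{dom}f^*$ that converges to a boundary point of $\operatorname{dom}f^*$. For every $\xi\in\operatorname{int}\operatorname{dom}f^*$, the function $x\mapsto\langle x,\xi\rangle-f(x)$ has a unique maximizer over $X$, and it is $Df^*(\xi)$. Suppose moreover that the uniform modulus serves every subgradient, i.e. that (1) holds for every $x_0\in\operatorname{dom}\partial f$ and every $\xi_0\in\partial f(x_0)$. Then $\operatorname{dom}f^*=X^*$, and the following hold. (ii) Put $\tilde\gamma(r)=\gamma(r)/r$ for $r>0$. If $\tilde\gamma$ is strictly increasing on $(0,\infty)$, then for all $\xi_1,\xi_2\in X^*$ $$\|Df^*(\xi_1)-Df^*(\xi_2)\|\le\tilde\gamma^{-1}\big(\|\xi_1-\xi_2\|_*/2\big),$$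 where $\tilde\gamma^{-1}$ is the inverse of $\tilde\gamma$, extended by $\tilde\gamma^{-1}(s)=\sup(\{0\}\cup\{r>0:\tilde\gamma(r)\le s\})\in[0,\infty]$ to all $s\in[0,\infty]$. Thus $Df^*$ is uniformly continuous with modulus of continuity $\chi(r)=\tilde\gamma^{-1}(r/2)$, which is non-decreasing with $\lim_{r\to0}\chi(r)=\chi(0)=0$. (iii) $f^*$ is uniformly essentially strongly smooth with modulus $\gamma^*$: it is proper and Fréchet differentiable, $\gamma^*\in\Gamma_L$, and for every $\xi_0\in\operatorname{dom}\partial f^*$ there is $x_0\in X^{**}=X$ with $f^*(\xi)\le f^*(\xi_0)+\langle x_0,\xi-\xi_0\rangle+\gamma^*(\|\xi-\xi_0\|_*)$ for all $\xi\in X^*$. -/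

import Mathlib

open Set Filter Topology
open scoped NNReal ENNReal

noncomputable section

namespace BanachDuality

section Functions

variable {Y : Type*}

/-- The effective domain `{x | f x < +∞}`. -/
def effDom (f : Y → EReal) : Set Y := {x | f x < ⊤}

/-- `f > -∞` everywhere and the effective domain is non-empty. -/
def IsProper (f : Y → EReal) : Prop := (∀ x, f x ≠ ⊥) ∧ (effDom f).Nonempty

variable [NormedAddCommGroup Y] [NormedSpace ℝ Y]

/-- Convexity of an extended real-valued function: its epigraph is convex. -/
def IsConvexFn (f : Y → EReal) : Prop := Convex ℝ {p : Y × ℝ | f p.1 ≤ (p.2 : EReal)}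

/-- The Legendre-Fenchel conjugate `f* (ξ) = sup_x ⟨x, ξ⟩ - f x`. -/
def conj (f : Y → EReal) (ξ : StrongDual ℝ Y) : EReal := ⨆ x : Y, ((ξ x : ℝ) : EReal) - f x

/-- The subdifferential `∂f (x)`. -/
def subdiff (f : Y → EReal) (x : Y) : Set (StrongDual ℝ Y) :=
  {ξ | ∀ y, f x + ((ξ (y - x) : ℝ) : EReal) ≤ f y}

/-- `dom ∂f = {x | ∂f (x) ≠ ∅}`. -/
def domSubdiff (f : Y → EReal) : Set Y := {x | (subdiff f x).Nonempty}

/-- The maximizers of `x ↦ ⟨x, ξ⟩ - f x`. -/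
def argmaxSet (f : Y → EReal) (ξ : StrongDual ℝ Y) : Set Y :=
  {x | ∀ y, ((ξ y : ℝ) : EReal) - f y ≤ ((ξ x : ℝ) : EReal) - f x}

/-- Fréchet differentiability of `f : Y → (-∞, +∞]` on the interior of its effective domain,
where `f` is real-valued. -/
def FrechetDifferentiableOnInterior (f : Y → EReal) : Prop :=
  ∀ x ∈ interior (effDom f), DifferentiableAt ℝ (fun y => (f y).toReal) x

/-- The Fréchet derivative `D f (x)` of `f : Y → (-∞, +∞]`; it is used only at points of the
interior of the effective domain, where `f` is differentiable. -/
def frechetDeriv (f : Y → EReal) (x : Y) : StrongDual ℝ Y :=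
  fderiv ℝ (fun y => (f y).toReal) x

/-- Essential Fréchet differentiability. -/
structure EssentiallyFrechetDifferentiable (f : Y → EReal) : Prop where
  proper : IsProper f
  convex : IsConvexFn f
  lsc : LowerSemicontinuous f
  interior_nonempty : (interior (effDom f)).Nonempty
  differentiable : FrechetDifferentiableOnInterior f
  blowup : ∀ (u : ℕ → Y) (x : Y), (∀ j, u j ∈ interior (effDom f)) →
    x ∈ frontier (effDom f) → Tendsto u atTop (𝓝 x) →
    Tendsto (fun j => ‖frechetDeriv f (u j)‖) atTop atTop

end Functions

/-- The class `Γ`: convex lower semicontinuous `γ : [0, ∞) → [0, ∞]` with `γ 0 = 0`. -/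
structure Gam (γ : ℝ≥0 → ℝ≥0∞) : Prop where
  convex : ConvexOn ℝ≥0 univ γ
  lsc : LowerSemicontinuous γ
  zero : γ 0 = 0

/-- The class `Γ_U`: members of `Γ` with `γ r > 0` for `r > 0`. -/
def GamU (γ : ℝ≥0 → ℝ≥0∞) : Prop := Gam γ ∧ ∀ r, 0 < r → 0 < γ r

/-- The quotient `γ r / r` (`0` at `r = 0` when `γ 0 = 0`). -/
def quot (γ : ℝ≥0 → ℝ≥0∞) (r : ℝ≥0) : ℝ≥0∞ := γ r / (r : ℝ≥0∞)

/-- The class `Γ_L`: members of `Γ` with `γ r / r → 0` as `r → 0`. -/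
def GamL (γ : ℝ≥0 → ℝ≥0∞) : Prop := Gam γ ∧ Tendsto (quot γ) (𝓝[>] 0) (𝓝 0)

/-- The conjugate `γ* (s) = sup_{r ≥ 0} (r s - γ r)`. As `γ 0 = 0`, the supremum is nonnegative
and the truncated subtraction does not change it. -/
def gamConj (γ : ℝ≥0 → ℝ≥0∞) (s : ℝ≥0) : ℝ≥0∞ :=
  ⨆ r : ℝ≥0, (r : ℝ≥0∞) * (s : ℝ≥0∞) - γ r

/-- The inverse of `r ↦ γ r / r`, extended to all `s ∈ [0, ∞]` as the supremum of the `r ≥ 0`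
with `r = 0` or `γ r / r ≤ s`: it is `0` below the range of the quotient and `+∞` above it. -/
def quotInv (γ : ℝ≥0 → ℝ≥0∞) (s : ℝ≥0∞) : ℝ≥0∞ :=
  ⨆ (r : ℝ≥0) (_ : r = 0 ∨ quot γ r ≤ s), (r : ℝ≥0∞)

/-- `quotInv γ` is the inverse of `r ↦ γ r / r` on the range, if the quotient is strictly
increasing. -/
theorem quotInv_quot {γ : ℝ≥0 → ℝ≥0∞} (h : StrictMonoOn (quot γ) (Ioi 0)) {r : ℝ≥0}
    (hr : 0 < r) : quotInv γ (quot γ r) = r := by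
  apply le_antisymm
  · refine iSup₂_le fun t ht => ?_
    rcases ht with rfl | ht
    · simp
    · rcases eq_or_ne t 0 with rfl | h0
      · simp
      · exact_mod_cast (h.le_iff_le (pos_iff_ne_zero.2 h0) hr).1 ht
  · exact le_iSup₂_of_le r (Or.inr le_rfl) le_rfl

section Strong

variable {Y : Type*} [NormedAddCommGroup Y] [NormedSpace ℝ Y]

/-- `f x ≥ f x₀ + ⟨x - x₀, ξ₀⟩ + γ (‖x - x₀‖)` for all `x`. -/
def StrongLowerBound (f : Y → EReal) (γ : ℝ≥0 → ℝ≥0∞) (x₀ : Y) (ξ₀ : StrongDual ℝ Y) : Prop :=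
  ∀ x, f x₀ + ((ξ₀ (x - x₀) : ℝ) : EReal) + ((γ ‖x - x₀‖₊ : ℝ≥0∞) : EReal) ≤ f x

/-- `f x ≤ f x₀ + ⟨ξ₀, x - x₀⟩ + κ (‖x - x₀‖)` for all `x`. -/
def SmoothUpperBound (f : Y → EReal) (κ : ℝ≥0 → ℝ≥0∞) (x₀ : Y) (ξ₀ : StrongDual ℝ Y) : Prop :=
  ∀ x, f x ≤ f x₀ + ((ξ₀ (x - x₀) : ℝ) : EReal) + ((κ ‖x - x₀‖₊ : ℝ≥0∞) : EReal)

/-- Uniform essential strong convexity with modulus `γ`. -/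
structure UniformlyEssentiallyStronglyConvex (f : Y → EReal) (γ : ℝ≥0 → ℝ≥0∞) : Prop where
  proper : IsProper f
  convex : IsConvexFn f
  lsc : LowerSemicontinuous f
  strict : ∀ S : Set Y, S ⊆ domSubdiff f → Convex ℝ S → ∀ x ∈ S, ∀ y ∈ S, x ≠ y →
    ∀ a b : ℝ, 0 < a → 0 < b → a + b = 1 →
      f (a • x + b • y) < (a : EReal) * f x + (b : EReal) * f y
  /-- The inverse of the subdifferential is locally bounded on its domain. -/
  locallyBounded : ∀ ξ₀ : StrongDual ℝ Y, (∃ x, ξ₀ ∈ subdiff f x) →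
    ∃ V ∈ 𝓝 ξ₀, Bornology.IsBounded {x | ∃ ξ ∈ V, ξ ∈ subdiff f x}
  modulus_mem : GamU γ
  strong : ∀ x₀ ∈ domSubdiff f, ∃ ξ₀ : StrongDual ℝ Y, StrongLowerBound f γ x₀ ξ₀

/-- Uniform essential strong smoothness with modulus `κ`. -/
structure UniformlyEssentiallyStronglySmooth (f : Y → EReal) (κ : ℝ≥0 → ℝ≥0∞) : Prop where
  proper : IsProper f
  differentiable : FrechetDifferentiableOnInterior f
  modulus_mem : GamL κ
  smooth : ∀ x₀ ∈ domSubdiff f, ∃ ξ₀ : StrongDual ℝ Y, SmoothUpperBound f κ x₀ ξ₀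

end Strong

end BanachDuality

end

namespace BanachDuality

/-! ### Extended-valued convex functions: affine minorants, continuity, subgradients. -/

section ConvexFunctions

variable {E : Type*} {f : E → EReal}

/-! Everything rests on Fenchel duality: `ξ ∈ subdiff f x` exactly when the image of `x` in the
bidual lies in `subdiff (conj f) ξ` (`IsConvexFn.inclusion_mem_subdiff_conj_iff`). By reflexivity
these are all the subgradients of `conj f`, and they are the maximizers of `⟨·, ξ⟩ - f`. Hahn–Banach
together with continuity of `conj f` (Baire) provides one at each interior point of the domain;
strict convexity makes it unique.

Fréchet differentiability is continuity of the maximizer in `ξ`: if `x`, `z` are the maximizers for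
`ξ`, `η`, the remainder `f* η - f* ξ - ⟨x, η - ξ⟩` lies between `0` and `⟨z - x, η - ξ⟩`. Continuity
(`eventually_norm_sub_lt`) is the delicate point, since the modulus may be available only for a
subgradient `ξ₀ ≠ ξ`. The discrepancy `ξ - ξ₀` is a fixed direction, and in it the unique
subgradient of `conj f` at `ξ` controls the difference quotients.

For the blow-up, bounded derivatives along a sequence would leave a subgradient at the boundary
limit. A normal direction to the domain could be added to it in any multiple, against local
boundedness of the inverse subdifferential.

If the modulus serves every subgradient, each interior point of the domain carries a ball of one
fixed radius, so the domain is everything. The continuity estimate comes from adding two strong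
convexity inequalities, and smoothness from conjugating one. -/

theorem IsProper.exists_coe (hf : IsProper f) {x : E} (hx : x ∈ effDom f) :
    ∃ a : ℝ, f x = a :=
  ⟨(f x).toReal, (EReal.coe_toReal (ne_of_lt hx) (hf.1 x)).symm⟩

theorem IsProper.coe_toReal (hf : IsProper f) {x : E} (hx : x ∈ effDom f) :
    ((f x).toReal : EReal) = f x :=
  EReal.coe_toReal (ne_of_lt hx) (hf.1 x)

theorem eq_top_of_notMem_effDom {x : E} (hx : x ∉ effDom f) : f x = ⊤ :=
  not_lt_top_iff.1 hx

theorem mem_effDom_of_le_coe {x : E} {a : ℝ} (h : f x ≤ a) : x ∈ effDom f :=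
  lt_of_le_of_lt h (EReal.coe_lt_top a)

theorem isClosed_real_epigraph [TopologicalSpace E] (hl : LowerSemicontinuous f) :
    IsClosed {p : E × ℝ | f p.1 ≤ (p.2 : EReal)} :=
  hl.isClosed_epigraph.preimage
    (continuous_fst.prodMk (continuous_coe_real_ereal.comp continuous_snd))

variable [NormedAddCommGroup E] [NormedSpace ℝ E]

theorem IsConvexFn.apply_le (hf : IsConvexFn f) {x y : E} {a b s t : ℝ} (hx : f x ≤ a)
    (hy : f y ≤ b) (hs : 0 ≤ s) (ht : 0 ≤ t) (hst : s + t = 1) :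
    f (s • x + t • y) ≤ ((s * a + t * b : ℝ) : EReal) := by
  simpa using hf (x := (x, a)) hx (y := (y, b)) hy hs ht hst

theorem IsConvexFn.convexOn_toReal (hf : IsConvexFn f) (hp : IsProper f) :
    ConvexOn ℝ (effDom f) fun x => (f x).toReal := by
  have key : ∀ ⦃x⦄, x ∈ effDom f → ∀ ⦃y⦄, y ∈ effDom f → ∀ ⦃s t : ℝ⦄, 0 ≤ s → 0 ≤ t → s + t = 1 →
      f (s • x + t • y) ≤ ((s * (f x).toReal + t * (f y).toReal : ℝ) : EReal) :=
    fun x hx y hy s t hs ht hst =>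
      hf.apply_le (hp.coe_toReal hx).ge (hp.coe_toReal hy).ge hs ht hst
  refine ⟨fun x hx y hy s t hs ht hst => mem_effDom_of_le_coe (key hx hy hs ht hst),
    fun x hx y hy s t hs ht hst => ?_⟩
  have h := key hx hy hs ht hst
  rw [← hp.coe_toReal (mem_effDom_of_le_coe h)] at h
  exact_mod_cast h

/-- Separation of a convex set from the strict hypograph of a concave function by the graph of a
continuous affine function. -/
theorem exists_affine_between_hypograph {U : Set E} {h : E → ℝ} (hU : IsOpen U)
    (hh : ConcaveOn ℝ U h) (hc : ContinuousOn h U) {A : Set (E × ℝ)} (hA : Convex ℝ A)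
    (hle : ∀ p ∈ A, p.1 ∈ U → h p.1 ≤ p.2) (hne : ∃ p ∈ A, p.1 ∈ U) :
    ∃ (g : StrongDual ℝ E) (c : ℝ), (∀ y ∈ U, h y ≤ g y + c) ∧ ∀ p ∈ A, g p.1 + c ≤ p.2 := by
  have hopen : IsOpen {p : E × ℝ | p.1 ∈ U ∧ p.2 < h p.1} := by
    have h1 : ContinuousOn (fun p : E × ℝ => h p.1 - p.2) (Prod.fst ⁻¹' U) :=
      (hc.comp continuousOn_fst fun p hp => hp).sub continuousOn_snd
    have h2 := h1.isOpen_inter_preimage (hU.preimage continuous_fst) (isOpen_Ioi (a := (0 : ℝ)))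
    convert h2 using 1
    ext p
    simp
  obtain ⟨F, u, hF1, hF2⟩ := geometric_hahn_banach_open hh.convex_strict_hypograph hopen hA
    (Set.disjoint_left.2 fun p hp hpA => (hle p hpA hp.1).not_gt hp.2)
  have hF : ∀ y r, F (y, r) = F (y, 0) + F (0, 1) * r := by
    intro y r
    have : (y, r) = (y, (0 : ℝ)) + r • ((0 : E), (1 : ℝ)) := by simp
    rw [this, map_add, map_smul, smul_eq_mul, mul_comm]
  set k := F (0, 1)
  -- The hyperplane is not vertical: some point of `A` lies over `U`, on the same vertical line as a
  -- point of the strict hypograph.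
  have hk : 0 < k := by
    obtain ⟨⟨x, r⟩, hxA, hxU⟩ := hne
    have h1 := hF1 (x, h x - 1) ⟨hxU, by simp⟩
    have h2 := hF2 _ hxA
    have h3 : h x ≤ r := hle _ hxA hxU
    rw [hF] at h1 h2
    by_contra hk
    nlinarith
  refine ⟨-(k⁻¹ • F.comp (ContinuousLinearMap.inl ℝ E ℝ)), k⁻¹ * u, fun y hy => ?_,
    fun p hp => ?_⟩
  · simp only [neg_apply, smul_apply, ContinuousLinearMap.comp_apply,
      ContinuousLinearMap.inl_apply, smul_eq_mul]
    refine le_of_forall_lt fun r hr => ?_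
    have h1 := hF1 (y, r) ⟨hy, hr⟩
    rw [hF] at h1
    have : k⁻¹ * (F (y, 0) + k * r) < k⁻¹ * u := by gcongr
    rw [mul_add, inv_mul_cancel_left₀ hk.ne'] at this
    linarith
  · simp only [neg_apply, smul_apply, ContinuousLinearMap.comp_apply,
      ContinuousLinearMap.inl_apply, smul_eq_mul]
    have h1 := hF2 p hp
    rw [show p = (p.1, p.2) from rfl, hF] at h1
    have : k⁻¹ * u ≤ k⁻¹ * (F (p.1, 0) + k * p.2) := by gcongr
    rw [mul_add, inv_mul_cancel_left₀ hk.ne'] at this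
    linarith

/-- A finite continuous concave function below a proper convex function is separated from it by a
continuous affine function. -/
theorem IsConvexFn.exists_affine_between (hf : IsConvexFn f) (hp : IsProper f) {h : E → ℝ}
    (hh : ConcaveOn ℝ univ h) (hc : Continuous h) (hle : ∀ x, (h x : EReal) ≤ f x) :
    ∃ (g : StrongDual ℝ E) (c : ℝ), (∀ y, h y ≤ g y + c) ∧
      ∀ y, ((g y + c : ℝ) : EReal) ≤ f y := by
  obtain ⟨x, hx⟩ := hp.2
  obtain ⟨g, c, h1, h2⟩ := exists_affine_between_hypograph isOpen_univ hh hc.continuousOn hf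
    (fun p hpA _ => EReal.coe_le_coe_iff.1 ((hle p.1).trans hpA))
    ⟨(x, (f x).toReal), (hp.coe_toReal hx).ge, trivial⟩
  refine ⟨g, c, fun y => h1 y trivial, fun y => ?_⟩
  by_cases hy : y ∈ effDom f
  · rw [← hp.coe_toReal hy]
    exact EReal.coe_le_coe_iff.2 (h2 (y, (f y).toReal) (hp.coe_toReal hy).ge)
  · rw [eq_top_of_notMem_effDom hy]
    exact le_top

/-- Separate the closed epigraph from a point directly below it; having `(x, a)` above `(x, a - 1)`
keeps the hyperplane from being vertical. -/
theorem IsConvexFn.exists_affine_minorant (hf : IsConvexFn f) (hp : IsProper f)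
    (hl : LowerSemicontinuous f) :
    ∃ (g : StrongDual ℝ E) (c : ℝ), ∀ y, ((g y + c : ℝ) : EReal) ≤ f y := by
  obtain ⟨x, hx⟩ := hp.2
  obtain ⟨a, ha⟩ := hp.exists_coe hx
  have hnot : (x, a - 1) ∉ {p : E × ℝ | f p.1 ≤ (p.2 : EReal)} := by
    simp only [mem_ofPred_eq, ha, EReal.coe_le_coe_iff]
    linarith
  obtain ⟨F, u, hF1, hF2⟩ := geometric_hahn_banach_point_closed hf (isClosed_real_epigraph hl) hnot
  have hF : ∀ y r, F (y, r) = F (y, 0) + F (0, 1) * r := by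
    intro y r
    have : (y, r) = (y, (0 : ℝ)) + r • ((0 : E), (1 : ℝ)) := by simp
    rw [this, map_add, map_smul, smul_eq_mul, mul_comm]
  set k := F (0, 1)
  have hk : 0 < k := by
    have := hF2 (x, a) ha.le
    rw [hF] at hF1 this
    nlinarith
  refine ⟨-(k⁻¹ • F.comp (ContinuousLinearMap.inl ℝ E ℝ)), k⁻¹ * u, fun y => ?_⟩
  by_cases hy : y ∈ effDom f
  · obtain ⟨b, hb⟩ := hp.exists_coe hy
    have h1 := hF2 (y, b) hb.le
    rw [hF] at h1
    have : k⁻¹ * u ≤ k⁻¹ * (F (y, 0) + k * b) := by gcongr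
    rw [mul_add, inv_mul_cancel_left₀ hk.ne'] at this
    rw [hb, EReal.coe_le_coe_iff]
    simp only [neg_apply, smul_apply, ContinuousLinearMap.comp_apply,
      ContinuousLinearMap.inl_apply, smul_eq_mul]
    linarith
  · rw [eq_top_of_notMem_effDom hy]
    exact le_top

theorem concaveOn_sub_const_mul_norm (r K : ℝ) (hK : 0 ≤ K) (x : E) :
    ConcaveOn ℝ univ fun y => r - K * ‖y - x‖ := by
  have h : ConvexOn ℝ univ fun y : E => K * ‖y - x‖ := by
    have := (convexOn_univ_norm (E := E)).translate_left (-x)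
    simp only [preimage_univ] at this
    exact (this.smul hK).congr fun y _ => by simp [sub_eq_add_neg]
  exact (concaveOn_const r convex_univ).sub h

/-- A proper convex lower semicontinuous function is the supremum of its continuous affine
minorants. -/
theorem IsConvexFn.exists_affine_minorant_ge (hf : IsConvexFn f) (hp : IsProper f)
    (hl : LowerSemicontinuous f) {x : E} {r : ℝ} (hr : (r : EReal) < f x) :
    ∃ (g : StrongDual ℝ E) (c : ℝ), (∀ y, ((g y + c : ℝ) : EReal) ≤ f y) ∧ r ≤ g x + c := by
  obtain ⟨g, c, hgc⟩ := hf.exists_affine_minorant hp hl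
  obtain ⟨δ, hδ, hball⟩ := Metric.eventually_nhds_iff.1 (hl x r hr)
  -- The cone with apex `(x, r)` and slope `K` lies below `f`: inside the `δ`-ball by
  -- semicontinuity, outside it because `K` is steep enough to pass below the affine minorant.
  set K : ℝ := ‖g‖ + |r - g x - c| / δ with hKdef
  have hK : 0 ≤ K := by positivity
  have hle : ∀ y, ((r - K * ‖y - x‖ : ℝ) : EReal) ≤ f y := by
    intro y
    rcases lt_or_ge (dist y x) δ with hy | hy
    · refine le_trans ?_ (hball hy).le
      rw [EReal.coe_le_coe_iff]
      have := mul_nonneg hK (norm_nonneg (y - x))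
      linarith
    · refine le_trans ?_ (hgc y)
      rw [EReal.coe_le_coe_iff]
      rw [dist_eq_norm] at hy
      have h1 : -(‖g‖ * ‖y - x‖) ≤ g (y - x) :=
        neg_le_of_abs_le (by simpa using g.le_opNorm (y - x))
      have h2 : |r - g x - c| ≤ |r - g x - c| / δ * ‖y - x‖ := by
        rw [div_mul_eq_mul_div, le_div_iff₀ hδ]
        gcongr
      have h3 := le_abs_self (r - g x - c)
      rw [map_sub] at h1
      rw [hKdef, add_mul]
      linarith
  obtain ⟨g', c', h1, h2⟩ := hf.exists_affine_between hp (concaveOn_sub_const_mul_norm r K hK x)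
    (by fun_prop) hle
  exact ⟨g', c', h2, by simpa using h1 x⟩

/-- A lower semicontinuous convex function on a Banach space is locally bounded above on the
interior of its effective domain. -/
theorem IsConvexFn.eventually_le [CompleteSpace E] (hf : IsConvexFn f) (hp : IsProper f)
    (hl : LowerSemicontinuous f) {x : E} (hx : x ∈ interior (effDom f)) :
    ∃ M : ℝ, ∀ᶠ y in 𝓝 x, f y ≤ M := by
  -- Sets for Baire's theorem. Bounding `f` on both sides of `x` lets the midpoint of `v₀ + v` and
  -- `-(v₀ - v)` turn a ball around `v₀` into one around `0`.
  let A : ℕ × ℕ → Set E := fun p =>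
    {v | f (x + ((p.2 : ℝ) + 1)⁻¹ • v) ≤ ((p.1 : ℝ) : EReal) ∧
      f (x - ((p.2 : ℝ) + 1)⁻¹ • v) ≤ ((p.1 : ℝ) : EReal)}
  have hclosed : ∀ p, IsClosed (A p) := fun p =>
    ((hl.comp (by fun_prop : Continuous fun v : E => x + ((p.2 : ℝ) + 1)⁻¹ • v)).isClosed_preimage
      _).inter
    ((hl.comp (by fun_prop : Continuous fun v : E => x - ((p.2 : ℝ) + 1)⁻¹ • v)).isClosed_preimage
      _)
  have hcover : ⋃ p, A p = univ := by
    refine eq_univ_of_forall fun v => ?_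
    have ht : Tendsto (fun k : ℕ => ((k : ℝ) + 1)⁻¹) atTop (𝓝 0) := by
      simpa using tendsto_one_div_add_atTop_nhds_zero_nat (𝕜 := ℝ)
    have h1 : ∀ᶠ k : ℕ in atTop, x + ((k : ℝ) + 1)⁻¹ • v ∈ effDom f := by
      have : Tendsto (fun k : ℕ => x + ((k : ℝ) + 1)⁻¹ • v) atTop (𝓝 x) := by
        simpa using (ht.smul_const v).const_add x
      exact this (mem_interior_iff_mem_nhds.1 hx)
    have h2 : ∀ᶠ k : ℕ in atTop, x - ((k : ℝ) + 1)⁻¹ • v ∈ effDom f := by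
      have : Tendsto (fun k : ℕ => x - ((k : ℝ) + 1)⁻¹ • v) atTop (𝓝 x) := by
        simpa using (ht.smul_const v).const_sub x
      exact this (mem_interior_iff_mem_nhds.1 hx)
    obtain ⟨k, hk1, hk2⟩ := (h1.and h2).exists
    obtain ⟨a, ha⟩ := hp.exists_coe hk1
    obtain ⟨b, hb⟩ := hp.exists_coe hk2
    obtain ⟨n, hn⟩ := exists_nat_ge (max a b)
    refine mem_iUnion.2 ⟨(n, k), ?_, ?_⟩
    · rw [ha, EReal.coe_le_coe_iff]
      exact (le_max_left _ _).trans hn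
    · rw [hb, EReal.coe_le_coe_iff]
      exact (le_max_right _ _).trans hn
  obtain ⟨⟨n, k⟩, v₀, hv₀⟩ := nonempty_interior_of_iUnion_of_closed hclosed hcover
  obtain ⟨r, hr, hball⟩ := Metric.mem_nhds_iff.1 (mem_interior_iff_mem_nhds.1 hv₀)
  have hbound : ∀ v : E, ‖v‖ < r → f (x + ((k : ℝ) + 1)⁻¹ • v) ≤ ((n : ℝ) : EReal) := by
    intro v hv
    have h1 := (hball (show v₀ + v ∈ Metric.ball v₀ r by simpa using hv)).1
    have h2 := (hball (show v₀ - v ∈ Metric.ball v₀ r by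
      simpa [Metric.mem_ball, dist_eq_norm] using hv)).2
    have h3 := hf.apply_le h1 h2 (s := 1 / 2) (t := 1 / 2) (by norm_num) (by norm_num)
      (by norm_num)
    convert h3 using 2
    · module
    · ring
  refine ⟨n, ?_⟩
  have hk : (0 : ℝ) < (k : ℝ) + 1 := by positivity
  have hcont : ContinuousAt (fun y : E => ‖((k : ℝ) + 1) • (y - x)‖) x := by fun_prop
  have hev : ∀ᶠ y in 𝓝 x, ‖((k : ℝ) + 1) • (y - x)‖ < r :=
    hcont.eventually_lt_const (by simpa using hr)
  filter_upwards [hev] with y hy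
  simpa [smul_smul, inv_mul_cancel₀ hk.ne'] using hbound _ hy

theorem IsConvexFn.continuousOn_toReal [CompleteSpace E] (hf : IsConvexFn f) (hp : IsProper f)
    (hl : LowerSemicontinuous f) :
    ContinuousOn (fun x => (f x).toReal) (interior (effDom f)) := by
  rcases (interior (effDom f)).eq_empty_or_nonempty with h0 | hne
  · simp [h0]
  have hconv := (hf.convexOn_toReal hp).subset interior_subset
    (hf.convexOn_toReal hp).1.interior
  refine ((hconv.continuousOn_tfae isOpen_interior hne).out 4 1).1 fun x hx => ?_
  obtain ⟨M, hM⟩ := hf.eventually_le hp hl hx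
  refine ⟨M, ?_⟩
  rw [eventually_map]
  filter_upwards [hM] with y hy
  rw [← hp.coe_toReal (mem_effDom_of_le_coe hy)] at hy
  exact_mod_cast hy

theorem mem_subdiff_iff (hp : IsProper f) {x : E} {g : StrongDual ℝ E} :
    g ∈ subdiff f x ↔
      x ∈ effDom f ∧ ∀ y ∈ effDom f, (f x).toReal + g (y - x) ≤ (f y).toReal := by
  constructor
  · intro h
    have hx : x ∈ effDom f := by
      obtain ⟨y, hy⟩ := hp.2
      by_contra hx
      have := h y
      rw [eq_top_of_notMem_effDom hx, EReal.top_add_coe, top_le_iff] at this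
      exact hy.ne this
    refine ⟨hx, fun y hy => ?_⟩
    have := h y
    rw [← hp.coe_toReal hx, ← hp.coe_toReal hy] at this
    exact_mod_cast this
  · rintro ⟨hx, h⟩ y
    by_cases hy : y ∈ effDom f
    · rw [← hp.coe_toReal hx, ← hp.coe_toReal hy]
      exact_mod_cast h y hy
    · rw [eq_top_of_notMem_effDom hy]
      exact le_top

/-- A lower Lipschitz estimate at a point of the domain yields a subgradient. -/
theorem IsConvexFn.subdiff_nonempty_of_sub_mul_norm_le (hf : IsConvexFn f) (hp : IsProper f)
    {x : E} {K : ℝ} (hK : 0 ≤ K) (hx : x ∈ effDom f)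
    (hle : ∀ y, (((f x).toReal - K * ‖y - x‖ : ℝ) : EReal) ≤ f y) : (subdiff f x).Nonempty := by
  obtain ⟨g, c, h1, h2⟩ := hf.exists_affine_between hp
    (concaveOn_sub_const_mul_norm (f x).toReal K hK x) (by fun_prop) hle
  have h3 : (f x).toReal ≤ g x + c := by simpa using h1 x
  refine ⟨g, (mem_subdiff_iff hp).2 ⟨hx, fun y hy => ?_⟩⟩
  have h4 := h2 y
  rw [← hp.coe_toReal hy, EReal.coe_le_coe_iff] at h4
  rw [map_sub]
  linarith

/-- A limit of points at which there are uniformly bounded subgradients has a subgradient. -/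
theorem IsConvexFn.subdiff_nonempty_of_tendsto (hf : IsConvexFn f) (hp : IsProper f)
    (hl : LowerSemicontinuous f) {ι : Type*} {l : Filter ι} {u : ι → E} {x : E}
    (hu : Tendsto u l (𝓝 x)) {M : ℝ} (hM : 0 ≤ M)
    (hfreq : ∃ᶠ j in l, ∃ g ∈ subdiff f (u j), ‖g‖ ≤ M) : (subdiff f x).Nonempty := by
  have key : ∀ y ∈ effDom f, f x ≤ (((f y).toReal + M * ‖y - x‖ : ℝ) : EReal) := by
    intro y hy
    by_contra! hlt
    obtain ⟨r, hr1, hr2⟩ := EReal.lt_iff_exists_real_btwn.1 hlt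
    rw [EReal.coe_lt_coe_iff] at hr1
    have h1 : ∀ᶠ j in l, (r : EReal) < f (u j) := hu.eventually (hl x r hr2)
    have h2 : ∀ᶠ j in l, (f y).toReal + M * ‖y - u j‖ < r :=
      (((hu.const_sub y).norm.const_mul M).const_add (f y).toReal).eventually_lt_const hr1
    obtain ⟨j, ⟨g, hg, hgM⟩, hj1, hj2⟩ := (hfreq.and_eventually (h1.and h2)).exists
    obtain ⟨hdom, hsub⟩ := (mem_subdiff_iff hp).1 hg
    have h3 := hsub y hy
    rw [← hp.coe_toReal hdom, EReal.coe_lt_coe_iff] at hj1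
    have h4 : -(M * ‖y - u j‖) ≤ g (y - u j) :=
      neg_le_of_abs_le ((g.le_opNorm _).trans (by gcongr))
    linarith
  obtain ⟨y₀, hy₀⟩ := hp.2
  have hx : x ∈ effDom f := mem_effDom_of_le_coe (key y₀ hy₀)
  refine hf.subdiff_nonempty_of_sub_mul_norm_le hp hM hx fun y => ?_
  by_cases hy : y ∈ effDom f
  · have := key y hy
    rw [← hp.coe_toReal hx, EReal.coe_le_coe_iff] at this
    rw [← hp.coe_toReal hy, EReal.coe_le_coe_iff]
    linarith
  · rw [eq_top_of_notMem_effDom hy]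
    exact le_top

/-- A subgradient at an interior point of the domain whose slope in a given direction dominates a
lower bound `d` for the difference quotients in this direction. -/
theorem IsConvexFn.exists_subgradient_direction [CompleteSpace E] (hf : IsConvexFn f)
    (hp : IsProper f) (hl : LowerSemicontinuous f) {x : E} (hx : x ∈ interior (effDom f)) (v : E)
    (d : ℝ) (hd : ∀ t : ℝ, 0 ≤ t → x + t • v ∈ interior (effDom f) →
      (f x).toReal + t * d ≤ (f (x + t • v)).toReal) :
    ∃ g ∈ subdiff f x, d ≤ g v := by
  have hconv := hf.convexOn_toReal hp
  have hconvU := hconv.subset interior_subset hconv.1.interior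
  -- Over the interior of the domain this ray stays above the concave function `-f`, touching its
  -- graph at `x`; a separating affine function has the required slope along `v`.
  let A : Set (E × ℝ) := {p | ∃ t : ℝ, 0 ≤ t ∧ p = (x + t • v, -((f x).toReal + t * d))}
  have hA : Convex ℝ A := by
    rintro _ ⟨t, ht, rfl⟩ _ ⟨t', ht', rfl⟩ a b ha hb hab
    refine ⟨a * t + b * t', by positivity, ?_⟩
    obtain rfl : b = 1 - a := by linarith
    refine Prod.ext ?_ ?_
    · simp only [Prod.smul_mk, Prod.mk_add_mk]
      module
    · simp only [Prod.smul_mk, Prod.mk_add_mk, smul_eq_mul]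
      ring
  obtain ⟨g, c, h1, h2⟩ := exists_affine_between_hypograph isOpen_interior hconvU.neg
    (hf.continuousOn_toReal hp hl).neg hA
    (by
      rintro _ ⟨t, ht, rfl⟩ hU
      simpa using hd t ht hU)
    ⟨_, ⟨0, le_rfl, rfl⟩, by simpa using hx⟩
  have hxc : g x + c = -(f x).toReal := by
    refine le_antisymm ?_ (h1 x hx)
    simpa using h2 _ ⟨0, le_rfl, rfl⟩
  refine ⟨-g, (mem_subdiff_iff hp).2 ⟨interior_subset hx, fun y hy => ?_⟩, ?_⟩
  -- Separation controls `f` only on the interior; convexity on the segment from `x` to `y` carries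
  -- the inequality to the whole domain.
  · have hlim : ∀ᶠ s : ℝ in 𝓝[>] 0, x + s • (y - x) ∈ interior (effDom f) := by
      have : ContinuousAt (fun s : ℝ => x + s • (y - x)) 0 := by fun_prop
      exact nhdsWithin_le_nhds (this (by simpa using isOpen_interior.mem_nhds hx))
    have hsmall : ∀ᶠ s : ℝ in 𝓝[>] 0, s < 1 :=
      nhdsWithin_le_nhds (eventually_lt_nhds one_pos)
    obtain ⟨s, ⟨hs, hs1⟩, hs0⟩ := ((hlim.and hsmall).and self_mem_nhdsWithin).exists
    have hs0 : 0 < s := hs0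
    have h3 := h1 _ hs
    have h4 := hconv.2 (interior_subset hx) hy (by linarith : (0 : ℝ) ≤ 1 - s) hs0.le
      (by ring)
    have h5 : (1 - s) • x + s • y = x + s • (y - x) := by module
    rw [h5] at h4
    simp only [Pi.neg_apply, map_add, map_smul, smul_eq_mul] at h3 h4
    simp only [neg_apply]
    have h6 : s * (-g (y - x)) ≤ s * ((f y).toReal - (f x).toReal) := by linarith
    have := le_of_mul_le_mul_left h6 hs0
    linarith
  · have := h2 _ ⟨1, zero_le_one, rfl⟩
    simp only [one_smul, map_add, one_mul] at this
    simp only [neg_apply]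
    linarith

/-- The difference quotients at an interior point with a unique subgradient. -/
theorem IsConvexFn.exists_lt_of_subdiff_subset [CompleteSpace E] (hf : IsConvexFn f)
    (hp : IsProper f) (hl : LowerSemicontinuous f) {x : E} (hx : x ∈ interior (effDom f))
    {g : StrongDual ℝ E} (hg : subdiff f x ⊆ {g}) (v : E) {ε : ℝ} (hε : 0 < ε) :
    ∃ t : ℝ, 0 < t ∧ x + t • v ∈ interior (effDom f) ∧
      (f (x + t • v)).toReal < (f x).toReal + t * (g v + ε) := by
  by_contra! hcon
  obtain ⟨g', hg', hle⟩ := hf.exists_subgradient_direction hp hl hx v (g v + ε) (by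
    intro t ht hU
    rcases ht.eq_or_lt with rfl | ht
    · simp
    · exact hcon t ht hU)
  rw [hg hg'] at hle
  linarith

/-- At a point of the domain outside its interior, the set of subgradients is unbounded if it is
non-empty. -/
theorem IsConvexFn.exists_forall_add_smul_mem_subdiff (hf : IsConvexFn f) (hp : IsProper f)
    (hne : (interior (effDom f)).Nonempty) {x : E} (hx : x ∉ interior (effDom f))
    {g : StrongDual ℝ E} (hg : g ∈ subdiff f x) :
    ∃ n : StrongDual ℝ E, n ≠ 0 ∧ ∀ t : ℝ, 0 ≤ t → g + t • n ∈ subdiff f x := by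
  have hconv := (hf.convexOn_toReal hp).1
  obtain ⟨n, hn⟩ := geometric_hahn_banach_open_point hconv.interior isOpen_interior hx
  have hdom : ∀ y ∈ effDom f, n y ≤ n x := by
    intro y hy
    have : y ∈ closure (interior (effDom f)) := by
      rw [hconv.closure_interior_eq_closure_of_nonempty_interior hne]
      exact subset_closure hy
    exact closure_minimal (fun z hz => (hn z hz).le)
      (isClosed_le n.continuous continuous_const) this
  refine ⟨n, ?_, fun t ht => ?_⟩
  · rintro rfl
    obtain ⟨y, hy⟩ := hne
    simpa using hn y hy
  · obtain ⟨h1, h2⟩ := (mem_subdiff_iff hp).1 hg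
    refine (mem_subdiff_iff hp).2 ⟨h1, fun y hy => ?_⟩
    have h3 := h2 y hy
    have h4 := mul_nonneg ht (sub_nonneg.2 (hdom y hy))
    simp only [add_apply, smul_apply, smul_eq_mul, map_sub] at h3 ⊢
    linarith

end ConvexFunctions

/-! ### Conjugates and Fenchel duality. -/

section Conjugate

variable {E : Type*} [NormedAddCommGroup E] [NormedSpace ℝ E] {f : E → EReal}

theorem conj_le_coe_iff {ξ : StrongDual ℝ E} {c : ℝ} :
    conj f ξ ≤ c ↔ ∀ x, ((ξ x - c : ℝ) : EReal) ≤ f x := by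
  refine iSup_le_iff.trans (forall_congr' fun x => ?_)
  induction f x with
  | bot => simp [-EReal.coe_sub]
  | top => simp
  | coe a =>
    norm_cast
    rw [sub_le_comm]

theorem le_conj (hp : IsProper f) {x : E} (hx : x ∈ effDom f) (ξ : StrongDual ℝ E) :
    ((ξ x - (f x).toReal : ℝ) : EReal) ≤ conj f ξ := by
  rw [EReal.coe_sub, hp.coe_toReal hx]
  exact le_iSup (fun y : E => ((ξ y : ℝ) : EReal) - f y) x

theorem conj_ne_bot (hp : IsProper f) (ξ : StrongDual ℝ E) : conj f ξ ≠ ⊥ := by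
  obtain ⟨x, hx⟩ := hp.2
  exact ne_bot_of_le_ne_bot (EReal.coe_ne_bot _) (le_conj hp hx ξ)

theorem IsConvexFn.isProper_conj (hf : IsConvexFn f) (hp : IsProper f)
    (hl : LowerSemicontinuous f) : IsProper (conj f) := by
  obtain ⟨g, c, hgc⟩ := hf.exists_affine_minorant hp hl
  exact ⟨conj_ne_bot hp, g, mem_effDom_of_le_coe (a := -c) (conj_le_coe_iff.2 (by simpa using hgc))⟩

theorem isConvexFn_conj (f : E → EReal) : IsConvexFn (conj f) := by
  rintro ⟨ξ, r⟩ hξ ⟨η, s⟩ hη a b ha hb hab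
  simp only [mem_ofPred_eq, conj_le_coe_iff] at hξ hη
  simp only [mem_ofPred_eq, Prod.smul_mk, Prod.mk_add_mk, conj_le_coe_iff, smul_eq_mul,
    add_apply, smul_apply]
  intro x
  have h1 := hξ x
  have h2 := hη x
  induction hfx : f x with
  | bot => simp [hfx, -EReal.coe_sub] at h1
  | top => exact le_top
  | coe c =>
    rw [hfx, EReal.coe_le_coe_iff] at h1 h2
    rw [EReal.coe_le_coe_iff]
    obtain rfl : b = 1 - a := by linarith
    nlinarith

theorem lowerSemicontinuous_conj (f : E → EReal) : LowerSemicontinuous (conj f) := by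
  refine lowerSemicontinuous_iSup fun x => Continuous.lowerSemicontinuous ?_
  induction f x with
  | bot => simpa using continuous_const
  | top => simpa using continuous_const
  | coe c =>
    simp only [← EReal.coe_sub]
    exact continuous_coe_real_ereal.comp (by fun_prop)

theorem mem_subdiff_iff_conj_le (hp : IsProper f) {x : E} {ξ : StrongDual ℝ E} :
    ξ ∈ subdiff f x ↔ x ∈ effDom f ∧ conj f ξ ≤ ((ξ x - (f x).toReal : ℝ) : EReal) := by
  rw [mem_subdiff_iff hp, conj_le_coe_iff]
  refine and_congr_right fun hx => ⟨fun h y => ?_, fun h y hy => ?_⟩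
  · by_cases hy : y ∈ effDom f
    · have := h y hy
      rw [← hp.coe_toReal hy, EReal.coe_le_coe_iff]
      rw [map_sub] at this
      linarith
    · rw [eq_top_of_notMem_effDom hy]
      exact le_top
  · have := h y
    rw [← hp.coe_toReal hy, EReal.coe_le_coe_iff] at this
    rw [map_sub]
    linarith

theorem mem_argmaxSet_iff (hp : IsProper f) {x : E} {ξ : StrongDual ℝ E} :
    x ∈ argmaxSet f ξ ↔ ξ ∈ subdiff f x := by
  have hiff : x ∈ argmaxSet f ξ ↔ conj f ξ ≤ ((ξ x : ℝ) : EReal) - f x := iSup_le_iff.symm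
  rw [hiff, mem_subdiff_iff_conj_le hp]
  by_cases hx : x ∈ effDom f
  · rw [EReal.coe_sub, hp.coe_toReal hx]
    simp [hx]
  · rw [eq_top_of_notMem_effDom hx]
    simp [hx, conj_ne_bot hp]

theorem inclusion_mem_subdiff_conj_of_mem_subdiff (hp : IsProper f) {x : E} {ξ : StrongDual ℝ E}
    (h : ξ ∈ subdiff f x) : NormedSpace.inclusionInDoubleDual ℝ E x ∈ subdiff (conj f) ξ := by
  obtain ⟨hx, hle⟩ := (mem_subdiff_iff_conj_le hp).1 h
  intro η
  refine le_trans ?_ (le_conj hp hx η)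
  refine (add_le_add_left hle _).trans ?_
  rw [← EReal.coe_add, EReal.coe_le_coe_iff, NormedSpace.dual_def, sub_apply]
  linarith

theorem IsConvexFn.inclusion_mem_subdiff_conj_iff (hf : IsConvexFn f) (hp : IsProper f)
    (hl : LowerSemicontinuous f) {x : E} {ξ : StrongDual ℝ E} :
    NormedSpace.inclusionInDoubleDual ℝ E x ∈ subdiff (conj f) ξ ↔ ξ ∈ subdiff f x := by
  refine ⟨fun h => ?_, inclusion_mem_subdiff_conj_of_mem_subdiff hp⟩
  have hp' := hf.isProper_conj hp hl
  obtain ⟨hξ, hsub⟩ := (mem_subdiff_iff hp').1 h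
  have hle : f x ≤ ((ξ x - (conj f ξ).toReal : ℝ) : EReal) := by
    by_contra! hlt
    obtain ⟨r, hr1, hr2⟩ := EReal.lt_iff_exists_real_btwn.1 hlt
    -- The slope `g` of a minorant that nearly touches `f` at `x` has `f* g ≤ -c`; testing the
    -- subgradient inequality at `g` gives the contradiction.
    obtain ⟨g, c, hgc, hr⟩ := hf.exists_affine_minorant_ge hp hl hr2
    have hg : conj f g ≤ ((-c : ℝ) : EReal) := conj_le_coe_iff.2 (by simpa using hgc)
    have h1 := hsub g (mem_effDom_of_le_coe hg)
    rw [← hp'.coe_toReal (mem_effDom_of_le_coe hg), EReal.coe_le_coe_iff] at hg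
    rw [EReal.coe_lt_coe_iff] at hr1
    rw [NormedSpace.dual_def, sub_apply] at h1
    linarith
  have hx := mem_effDom_of_le_coe hle
  refine (mem_subdiff_iff_conj_le hp).2 ⟨hx, ?_⟩
  rw [← hp.coe_toReal hx, EReal.coe_le_coe_iff] at hle
  rw [← hp'.coe_toReal hξ, EReal.coe_le_coe_iff]
  linarith

/-- In a reflexive space, the maximum in the definition of the conjugate is attained at interior
points of its domain. -/
theorem IsConvexFn.exists_mem_subdiff
    (hrefl : Function.Surjective (NormedSpace.inclusionInDoubleDual ℝ E)) (hf : IsConvexFn f)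
    (hp : IsProper f) (hl : LowerSemicontinuous f) {ξ : StrongDual ℝ E}
    (hξ : ξ ∈ interior (effDom (conj f))) : ∃ x, ξ ∈ subdiff f x := by
  obtain ⟨G, hG, -⟩ := (isConvexFn_conj f).exists_subgradient_direction (hf.isProper_conj hp hl)
    (lowerSemicontinuous_conj f) hξ 0 0 (by simp)
  obtain ⟨x, rfl⟩ := hrefl G
  exact ⟨x, (hf.inclusion_mem_subdiff_conj_iff hp hl).1 hG⟩

theorem isProper_add_norm {E : Type*} [NormedAddCommGroup E] {f : E → EReal} (hp : IsProper f) :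
    IsProper fun x => f x + ((‖x‖ : ℝ) : EReal) := by
  refine ⟨fun x => ?_, hp.2.imp fun x hx => ?_⟩
  · simp [EReal.add_eq_bot_iff, hp.1 x]
  · exact EReal.add_lt_top (ne_of_lt hx) (EReal.coe_ne_top _)

theorem add_coe_le_coe_iff {a : EReal} {b c : ℝ} : a + b ≤ c ↔ a ≤ ((c - b : ℝ) : EReal) := by
  induction a with
  | bot => simp [-EReal.coe_sub]
  | top => simp [-EReal.coe_sub]
  | coe a =>
    norm_cast
    exact le_sub_iff_add_le.symm

theorem IsConvexFn.add_norm (hf : IsConvexFn f) :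
    IsConvexFn fun x => f x + ((‖x‖ : ℝ) : EReal) := by
  rintro ⟨x, r⟩ hx ⟨y, s⟩ hy a b ha hb hab
  simp only [mem_ofPred_eq, add_coe_le_coe_iff] at hx hy
  simp only [mem_ofPred_eq, Prod.smul_mk, Prod.mk_add_mk, add_coe_le_coe_iff, smul_eq_mul]
  refine (hf.apply_le hx hy ha hb hab).trans ?_
  have h : ‖a • x + b • y‖ ≤ a * ‖x‖ + b * ‖y‖ := by
    refine (norm_add_le _ _).trans_eq ?_
    rw [norm_smul_of_nonneg ha, norm_smul_of_nonneg hb]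
  rw [EReal.coe_le_coe_iff]
  linarith

theorem lowerSemicontinuous_add_norm {E : Type*} [NormedAddCommGroup E] {f : E → EReal}
    (hl : LowerSemicontinuous f) :
    LowerSemicontinuous fun x => f x + ((‖x‖ : ℝ) : EReal) :=
  hl.add' (continuous_coe_real_ereal.comp continuous_norm).lowerSemicontinuous fun _ =>
    EReal.continuousAt_add (Or.inr (EReal.coe_ne_bot _)) (Or.inr (EReal.coe_ne_top _))

/-- A proper convex lower semicontinuous function on a reflexive space has a subgradient. -/
theorem IsConvexFn.domSubdiff_nonempty
    (hrefl : Function.Surjective (NormedSpace.inclusionInDoubleDual ℝ E)) (hf : IsConvexFn f)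
    (hp : IsProper f) (hl : LowerSemicontinuous f) : (domSubdiff f).Nonempty := by
  obtain ⟨η, c, hη⟩ := hf.exists_affine_minorant hp hl
  -- Adding the norm makes the conjugate finite on a unit ball around `η`, so a maximizer exists
  -- there; being 1-Lipschitz, the norm can be removed afterwards.
  have hint : η ∈ interior (effDom (conj fun x => f x + ((‖x‖ : ℝ) : EReal))) := by
    refine mem_interior.2 ⟨Metric.ball η 1, fun ξ hξ => ?_, Metric.isOpen_ball,
      Metric.mem_ball_self one_pos⟩
    refine mem_effDom_of_le_coe (a := -c) (conj_le_coe_iff.2 fun x => ?_)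
    refine le_trans ?_ (add_le_add_left (hη x) _)
    rw [← EReal.coe_add, EReal.coe_le_coe_iff]
    have h1 : (ξ - η) x ≤ 1 * ‖x‖ :=
      (le_abs_self _).trans (ContinuousLinearMap.le_of_opNorm_le _
        (mem_ball_iff_norm.1 hξ).le x)
    rw [sub_apply] at h1
    linarith
  obtain ⟨x, hx⟩ := hf.add_norm.exists_mem_subdiff hrefl (isProper_add_norm hp)
    (lowerSemicontinuous_add_norm hl) hint
  obtain ⟨hxd, hsub⟩ := (mem_subdiff_iff (isProper_add_norm hp)).1 hx
  have hdom : ∀ y, y ∈ effDom f ↔ y ∈ effDom fun x => f x + ((‖x‖ : ℝ) : EReal) := by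
    intro y
    refine ⟨fun hy => EReal.add_lt_top (ne_of_lt hy) (EReal.coe_ne_top _), fun hy => ?_⟩
    by_contra h
    have : (f y + ((‖y‖ : ℝ) : EReal)) < ⊤ := hy
    rw [eq_top_of_notMem_effDom h, EReal.top_add_coe] at this
    exact this.ne rfl
  have hreal : ∀ y ∈ effDom f, (f y + ((‖y‖ : ℝ) : EReal)).toReal = (f y).toReal + ‖y‖ := by
    intro y hy
    rw [EReal.toReal_add (ne_of_lt hy) (hp.1 y) (EReal.coe_ne_top _) (EReal.coe_ne_bot _),
      EReal.toReal_coe]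
  have hxf := (hdom x).2 hxd
  refine ⟨x, hf.subdiff_nonempty_of_sub_mul_norm_le hp (K := 1 + ‖η‖) (by positivity) hxf
    fun y => ?_⟩
  by_cases hy : y ∈ effDom f
  · have h1 := hsub y ((hdom y).1 hy)
    rw [hreal x hxf, hreal y hy] at h1
    rw [← hp.coe_toReal hy, EReal.coe_le_coe_iff]
    have h2 : -(‖η‖ * ‖y - x‖) ≤ η (y - x) := neg_le_of_abs_le (by simpa using η.le_opNorm (y - x))
    have h3 := norm_sub_norm_le y x
    linarith
  · rw [eq_top_of_notMem_effDom hy]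
    exact le_top

end Conjugate

/-! ### Moduli, their conjugates and the inverse quotient. -/

section Modulus

variable {γ : ℝ≥0 → ℝ≥0∞}

theorem Gam.apply_mul_le (h : Gam γ) {t : ℝ≥0} (ht : t ≤ 1) (r : ℝ≥0) : γ (t * r) ≤ t * γ r := by
  have := h.convex.2 (mem_univ r) (mem_univ 0) zero_le zero_le
    (add_tsub_cancel_of_le ht)
  simpa [h.zero, ENNReal.smul_def] using this

theorem Gam.mul_le_mul (h : Gam γ) {s r : ℝ≥0} (hsr : s ≤ r) :
    (r : ℝ≥0∞) * γ s ≤ s * γ r := by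
  rcases eq_or_ne r 0 with rfl | hr
  · simp
  have h1 := h.apply_mul_le (div_le_one_of_le₀ hsr zero_le) r
  rw [div_mul_cancel₀ s hr] at h1
  calc (r : ℝ≥0∞) * γ s ≤ r * ((s / r : ℝ≥0) * γ r) := by gcongr
    _ = s * γ r := by rw [← mul_assoc, ← ENNReal.coe_mul, mul_div_cancel₀ s hr]

theorem Gam.monotone (h : Gam γ) : Monotone γ := by
  intro s r hsr
  rcases eq_or_ne r 0 with rfl | hr
  · rw [le_zero_iff.1 hsr]
  have hdiv := div_le_one_of_le₀ hsr zero_le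
  have h1 := h.apply_mul_le hdiv r
  rw [div_mul_cancel₀ s hr] at h1
  refine h1.trans (mul_le_of_le_one_left zero_le ?_)
  exact_mod_cast hdiv

theorem gam_gamConj (γ : ℝ≥0 → ℝ≥0∞) : Gam (gamConj γ) where
  convex := by
    refine ⟨convex_univ, fun s _ t _ a b _ _ hab => iSup_le fun r => ?_⟩
    have hs : (r : ℝ≥0∞) * s - γ r ≤ gamConj γ s :=
      le_iSup (fun r : ℝ≥0 => (r : ℝ≥0∞) * s - γ r) r
    have ht : (r : ℝ≥0∞) * t - γ r ≤ gamConj γ t :=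
      le_iSup (fun r : ℝ≥0 => (r : ℝ≥0∞) * t - γ r) r
    rw [tsub_le_iff_right] at hs ht ⊢
    have hab' : (a : ℝ≥0∞) + b = 1 := by exact_mod_cast hab
    simp only [ENNReal.smul_def, smul_eq_mul, ENNReal.coe_add, ENNReal.coe_mul]
    calc (r : ℝ≥0∞) * (a * s + b * t) = a * (r * s) + b * (r * t) := by ring
      _ ≤ a * (gamConj γ s + γ r) + b * (gamConj γ t + γ r) := by gcongr
      _ = a * gamConj γ s + b * gamConj γ t + (a + b) * γ r := by ring
      _ = a * gamConj γ s + b * gamConj γ t + γ r := by rw [hab', one_mul]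
  lsc := lowerSemicontinuous_iSup fun r => Continuous.lowerSemicontinuous <|
    (ENNReal.continuous_sub_right (γ r)).comp
      ((ENNReal.continuous_const_mul ENNReal.coe_ne_top).comp ENNReal.continuous_coe)
  zero := by simp [gamConj]

/-- For `s < c / e` with `c < γ e`, only `r ≤ e` can contribute positively to the supremum, since `γ
r / r` is non-decreasing; those `r` contribute at most `e * s`. -/
theorem GamU.gamL_gamConj (h : GamU γ) : GamL (gamConj γ) := by
  refine ⟨gam_gamConj γ, ENNReal.tendsto_nhds_zero.2 fun ε hε => ?_⟩
  obtain ⟨e, he0, heε⟩ := ENNReal.lt_iff_exists_nnreal_btwn.1 hε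
  have he : 0 < e := by exact_mod_cast he0
  obtain ⟨c, hc0, hcγ⟩ := ENNReal.lt_iff_exists_nnreal_btwn.1 (h.2 e he)
  have hc : 0 < c := by exact_mod_cast hc0
  have hev : ∀ᶠ s in 𝓝[>] (0 : ℝ≥0), s < c / e :=
    nhdsWithin_le_nhds (eventually_lt_nhds (div_pos hc he))
  filter_upwards [hev] with s hs
  refine ENNReal.div_le_of_le_mul (iSup_le fun r => tsub_le_iff_right.2 ?_)
  rcases le_total r e with hr | hr
  · refine le_add_right ?_
    gcongr
    exact (ENNReal.coe_le_coe.2 hr).trans heε.le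
  · refine le_add_left ?_
    have h1 := h.1.mul_le_mul hr
    have hes : e * s ≤ c := ((lt_div_iff₀' he).1 hs).le
    have h2 : (e : ℝ≥0∞) * (r * s) ≤ e * γ r := by
      calc (e : ℝ≥0∞) * (r * s) = r * (e * s) := by ring
        _ ≤ r * γ e := by
          gcongr
          refine le_trans ?_ hcγ.le
          exact_mod_cast hes
        _ ≤ e * γ r := h1
    exact (ENNReal.mul_le_mul_iff_right (by exact_mod_cast he.ne') ENNReal.coe_ne_top).1 h2

theorem quotInv_mono : Monotone (quotInv γ) := fun _ _ hst =>
  iSup₂_le fun r hr => le_iSup₂_of_le r (hr.imp_right fun h => h.trans hst) le_rfl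

theorem tendsto_quotInv_div_two (h : GamU γ) (hmono : StrictMonoOn (quot γ) (Ioi 0)) :
    Tendsto (fun r : ℝ≥0∞ => quotInv γ (r / 2)) (𝓝 0) (𝓝 0) := by
  refine ENNReal.tendsto_nhds_zero.2 fun ε hε => ?_
  obtain ⟨e, he0, heε⟩ := ENNReal.lt_iff_exists_nnreal_btwn.1 hε
  have he : 0 < e := by exact_mod_cast he0
  have hq : 0 < quot γ e := ENNReal.div_pos (h.2 e he).ne' ENNReal.coe_ne_top
  have hev : ∀ᶠ r in 𝓝 (0 : ℝ≥0∞), r < quot γ e := eventually_lt_nhds hq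
  filter_upwards [hev] with r hr
  calc quotInv γ (r / 2) ≤ quotInv γ (quot γ e) :=
        quotInv_mono (ENNReal.half_le_self.trans hr.le)
    _ = e := quotInv_quot hmono he
    _ ≤ ε := heε.le

end Modulus

/-! ### Strong lower bounds and their consequences for the conjugate. -/

section StrongConvexity

variable {X : Type*} [NormedAddCommGroup X] [NormedSpace ℝ X] {f : X → EReal}
  {γ : ℝ≥0 → ℝ≥0∞} {x₀ : X} {ξ₀ : StrongDual ℝ X}

theorem StrongLowerBound.mem_subdiff (h : StrongLowerBound f γ x₀ ξ₀) : ξ₀ ∈ subdiff f x₀ :=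
  fun x => le_trans (by simpa using add_le_add_right (EReal.coe_ennreal_nonneg _) _) (h x)

theorem StrongLowerBound.add_coe_le (h : StrongLowerBound f γ x₀ ξ₀) (hp : IsProper f) {x : X}
    {k : ℝ≥0} (hk : (k : ℝ≥0∞) ≤ γ ‖x - x₀‖₊) :
    (((f x₀).toReal + ξ₀ (x - x₀) + k : ℝ) : EReal) ≤ f x := by
  have hx₀ := ((mem_subdiff_iff hp).1 h.mem_subdiff).1
  refine le_trans ?_ (h x)
  rw [EReal.coe_add, EReal.coe_add, hp.coe_toReal hx₀]
  refine add_le_add_right ?_ _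
  exact EReal.coe_ennreal_le_coe_ennreal_iff.2 hk

theorem StrongLowerBound.add_le_toReal (h : StrongLowerBound f γ x₀ ξ₀) (hp : IsProper f) {x : X}
    (hx : x ∈ effDom f) {k : ℝ≥0} (hk : (k : ℝ≥0∞) ≤ γ ‖x - x₀‖₊) :
    (f x₀).toReal + ξ₀ (x - x₀) + k ≤ (f x).toReal := by
  have := h.add_coe_le hp hk
  rwa [← hp.coe_toReal hx, EReal.coe_le_coe_iff] at this

/-- A uniform radius of balls contained in the domain of the conjugate. -/
theorem GamU.exists_ball_subset_effDom_conj (hγ : GamU γ) (hp : IsProper f) :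
    ∃ δ > 0, ∀ x₀ ξ₀, StrongLowerBound f γ x₀ ξ₀ → Metric.ball ξ₀ δ ⊆ effDom (conj f) := by
  obtain ⟨c, hc0, hcγ⟩ := ENNReal.lt_iff_exists_nnreal_btwn.1 (hγ.2 1 one_pos)
  have hc : (0 : ℝ) < c := by exact_mod_cast hc0
  refine ⟨c, hc, fun x₀ ξ₀ h ξ hξ => ?_⟩
  -- The extra `c` absorbs `ξ - ξ₀` on the unit ball around `x₀`; outside it `γ r ≥ r * γ 1` does.
  refine mem_effDom_of_le_coe (a := ξ x₀ - (f x₀).toReal + c) (conj_le_coe_iff.2 fun x => ?_)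
  have h1 : (ξ - ξ₀) (x - x₀) ≤ c * ‖x - x₀‖ :=
    (le_abs_self _).trans (ContinuousLinearMap.le_of_opNorm_le _ (mem_ball_iff_norm.1 hξ).le _)
  rw [sub_apply, map_sub, map_sub] at h1
  rcases le_total 1 ‖x - x₀‖₊ with hr | hr
  · refine le_trans ?_ (h.add_coe_le hp (k := ‖x - x₀‖₊ * c) ?_)
    · rw [EReal.coe_le_coe_iff, map_sub, NNReal.coe_mul, coe_nnnorm]
      linarith
    · have := hγ.1.mul_le_mul hr
      rw [ENNReal.coe_one, one_mul] at this
      rw [ENNReal.coe_mul]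
      exact le_trans (by gcongr) this
  · refine le_trans ?_ (h.add_coe_le hp (k := 0) (by simp))
    have hr' : ‖x - x₀‖ ≤ 1 := by exact_mod_cast hr
    have := mul_le_of_le_one_right hc.le hr'
    rw [EReal.coe_le_coe_iff, map_sub, NNReal.coe_zero]
    linarith

namespace UniformlyEssentiallyStronglyConvex

/-- The points with subgradient `ξ` form a convex subset of `domSubdiff f` on which `f` is affine,
so strict convexity leaves at most one. -/
theorem eq_of_mem_subdiff (hf : UniformlyEssentiallyStronglyConvex f γ) {ξ : StrongDual ℝ X}
    {x y : X} (hx : ξ ∈ subdiff f x) (hy : ξ ∈ subdiff f y) : x = y := by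
  by_contra hne
  have hS : ∀ z, z ∈ {z | ξ ∈ subdiff f z} ↔ z ∈ effDom f ∧
      f z ≤ ((ξ z - (conj f ξ).toReal : ℝ) : EReal) := by
    intro z
    rw [mem_ofPred_eq, mem_subdiff_iff_conj_le hf.proper]
    refine and_congr_right fun hz => ?_
    rw [← (hf.convex.isProper_conj hf.proper hf.lsc).coe_toReal
      (mem_effDom_of_le_coe ((mem_subdiff_iff_conj_le hf.proper).1 hx).2),
      ← hf.proper.coe_toReal hz, EReal.toReal_coe, EReal.coe_le_coe_iff, EReal.coe_le_coe_iff]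
    exact le_sub_comm
  have hconv : Convex ℝ {z | ξ ∈ subdiff f z} := by
    intro z hz w hw a b ha hb hab
    have h1 := hf.convex.apply_le ((hS z).1 hz).2 ((hS w).1 hw).2 ha hb hab
    refine (hS _).2 ⟨mem_effDom_of_le_coe h1, h1.trans_eq ?_⟩
    obtain rfl : b = 1 - a := by linarith
    simp only [map_add, map_smul, smul_eq_mul]
    congr 1
    ring
  have hlt := hf.strict {z | ξ ∈ subdiff f z} (fun z hz => ⟨ξ, hz⟩) hconv x hx y hy hne (1 / 2)
    (1 / 2) (by norm_num) (by norm_num) (by norm_num)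
  have hm : ξ ∈ subdiff f ((1 / 2 : ℝ) • x + (1 / 2 : ℝ) • y) :=
    hconv hx hy (by norm_num) (by norm_num) (by norm_num)
  obtain ⟨hmd, -⟩ := (mem_subdiff_iff hf.proper).1 hm
  obtain ⟨hxd, -⟩ := (mem_subdiff_iff hf.proper).1 hx
  obtain ⟨hyd, -⟩ := (mem_subdiff_iff hf.proper).1 hy
  have h1 := ((mem_subdiff_iff hf.proper).1 hx).2 _ hmd
  have h2 := ((mem_subdiff_iff hf.proper).1 hy).2 _ hmd
  rw [← hf.proper.coe_toReal hmd, ← hf.proper.coe_toReal hxd, ← hf.proper.coe_toReal hyd] at hlt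
  have hlt' : (f ((1 / 2 : ℝ) • x + (1 / 2 : ℝ) • y)).toReal <
      1 / 2 * (f x).toReal + 1 / 2 * (f y).toReal := by exact_mod_cast hlt
  simp only [map_sub, map_add, map_smul, smul_eq_mul] at h1 h2
  linarith

theorem isProper_conj (hf : UniformlyEssentiallyStronglyConvex f γ) : IsProper (conj f) :=
  hf.convex.isProper_conj hf.proper hf.lsc

theorem subdiff_conj_subset
    (hrefl : Function.Surjective (NormedSpace.inclusionInDoubleDual ℝ X))
    (hf : UniformlyEssentiallyStronglyConvex f γ) {x : X} {ξ : StrongDual ℝ X}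
    (hx : ξ ∈ subdiff f x) :
    subdiff (conj f) ξ ⊆ {NormedSpace.inclusionInDoubleDual ℝ X x} := by
  intro G hG
  obtain ⟨z, rfl⟩ := hrefl G
  rw [hf.convex.inclusion_mem_subdiff_conj_iff hf.proper hf.lsc] at hG
  rw [hf.eq_of_mem_subdiff hG hx]
  rfl

theorem add_apply_le_conj (hf : UniformlyEssentiallyStronglyConvex f γ) {x : X}
    {ξ : StrongDual ℝ X} (hx : ξ ∈ subdiff f x) {η : StrongDual ℝ X}
    (hη : η ∈ effDom (conj f)) :
    (conj f ξ).toReal + (η x - ξ x) ≤ (conj f η).toReal :=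
  ((mem_subdiff_iff hf.isProper_conj).1
    (inclusion_mem_subdiff_conj_of_mem_subdiff hf.proper hx)).2 η hη

/-- The maximizers of `x ↦ ⟨x, ξ⟩ - f x` depend continuously on `ξ`. -/
theorem eventually_norm_sub_lt
    (hrefl : Function.Surjective (NormedSpace.inclusionInDoubleDual ℝ X))
    (hf : UniformlyEssentiallyStronglyConvex f γ) {x : X} {ξ : StrongDual ℝ X}
    (hξ : ξ ∈ interior (effDom (conj f))) (hx : ξ ∈ subdiff f x) {ε : ℝ} (hε : 0 < ε) :
    ∀ᶠ η in 𝓝 ξ, ∀ z, η ∈ subdiff f z → ‖z - x‖ < ε := by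
  have hp' := hf.isProper_conj
  have hcont := (isConvexFn_conj f).continuousOn_toReal hp' (lowerSemicontinuous_conj f)
  have hcontAt : ∀ η ∈ interior (effDom (conj f)),
      ContinuousAt (fun η => (conj f η).toReal) η := fun η hη =>
    hcont.continuousAt (isOpen_interior.mem_nhds hη)
  obtain ⟨ξ₀, hstrong⟩ := hf.strong x ⟨ξ, hx⟩
  lift ε to ℝ≥0 using hε.le
  obtain ⟨k, hk0, hkγ⟩ := ENNReal.lt_iff_exists_nnreal_btwn.1 (hf.modulus_mem.2 ε hε)
  have hk : (0 : ℝ) < k := by exact_mod_cast hk0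
  -- If `‖z - x‖ ≥ ε`, strong convexity and `η ∈ subdiff f z` give `(η - ξ) (z - x) + ζ (z - x) ≥
  -- k`. The step `t` along `ζ` is chosen to contradict this.
  set ζ := ξ - ξ₀ with hζ
  obtain ⟨t, ht, htU, hlt⟩ := (isConvexFn_conj f).exists_lt_of_subdiff_subset hp'
    (lowerSemicontinuous_conj f) hξ (hf.subdiff_conj_subset hrefl hx) ζ hk
  rw [NormedSpace.dual_def] at hlt
  have hT1 : ContinuousAt (fun η : StrongDual ℝ X => η + t • ζ) ξ := by fun_prop
  have hT2 : ContinuousAt (fun η : StrongDual ℝ X => η + (η - ξ)) ξ := by fun_prop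
  have hT3 : ContinuousAt (fun η : StrongDual ℝ X => t * (η x - ξ x)) ξ := by fun_prop
  have hC1 : ContinuousAt (fun η => (conj f (η + t • ζ)).toReal) ξ :=
    ContinuousAt.comp' (f := fun η : StrongDual ℝ X => η + t • ζ) (hcontAt _ htU) hT1
  have hC2 : ContinuousAt (fun η => (conj f (η + (η - ξ))).toReal) ξ :=
    ContinuousAt.comp' (f := fun η : StrongDual ℝ X => η + (η - ξ))
      (hcontAt _ (by simpa using hξ)) hT2
  have hC0 := hcontAt ξ hξ
  -- Increments of `conj f` from `η` bound `(η - ξ) z` and `t * ζ z`, with no a priori bound on `z`;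
  -- at `η = ξ` the inequality is the choice of `t`.
  have hev : ∀ᶠ η in 𝓝 ξ, t * ((conj f (η + (η - ξ))).toReal - (conj f η).toReal)
      - t * (η x - ξ x) + ((conj f (η + t • ζ)).toReal - (conj f η).toReal) < t * (ζ x + k) := by
    have hC : ContinuousAt (fun η => t * ((conj f (η + (η - ξ))).toReal - (conj f η).toReal)
        - t * (η x - ξ x) + ((conj f (η + t • ζ)).toReal - (conj f η).toReal)) ξ :=
      (((hC2.sub hC0).const_mul t).sub hT3).add (hC1.sub hC0)
    refine hC.tendsto.eventually_lt_const ?_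
    simp only [sub_self, add_zero, mul_zero, zero_add]
    linarith
  filter_upwards [hev, hT1 (mem_interior_iff_mem_nhds.1 htU),
    hT2 (by simpa using mem_interior_iff_mem_nhds.1 hξ)] with η h1 h2 h3 z hz
  by_contra! hle
  have hkz : (k : ℝ≥0∞) ≤ γ ‖z - x‖₊ := hkγ.le.trans (hf.modulus_mem.1.monotone hle)
  have hzd := ((mem_subdiff_iff hf.proper).1 hz).1
  have hxd := ((mem_subdiff_iff hf.proper).1 hx).1
  have e1 := hstrong.add_le_toReal hf.proper hzd hkz
  have e2 := ((mem_subdiff_iff hf.proper).1 hz).2 x hxd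
  have e3 := hf.add_apply_le_conj hz h2
  have e4 := hf.add_apply_le_conj hz h3
  simp only [hζ, add_apply, sub_apply, smul_apply, smul_eq_mul, map_sub] at *
  have e5 : t * (k : ℝ) ≤ t * ((η z - ξ z) - (η x - ξ x) + ((ξ z - ξ₀ z) - (ξ x - ξ₀ x))) :=
    mul_le_mul_of_nonneg_left (by linarith) ht.le
  have e6 : t * (η z - ξ z) ≤ t * ((conj f (η + (η - ξ))).toReal - (conj f η).toReal) :=
    mul_le_mul_of_nonneg_left (by linarith) ht.le
  linarith

theorem hasFDerivAt_conj
    (hrefl : Function.Surjective (NormedSpace.inclusionInDoubleDual ℝ X))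
    (hf : UniformlyEssentiallyStronglyConvex f γ) {x : X} {ξ : StrongDual ℝ X}
    (hξ : ξ ∈ interior (effDom (conj f))) (hx : ξ ∈ subdiff f x) :
    HasFDerivAt (fun η => (conj f η).toReal) (NormedSpace.inclusionInDoubleDual ℝ X x) ξ := by
  rw [hasFDerivAt_iff_isLittleO, Asymptotics.isLittleO_iff]
  intro c hc
  filter_upwards [hf.eventually_norm_sub_lt hrefl hξ hx hc, isOpen_interior.mem_nhds hξ]
    with η hη hηU
  obtain ⟨z, hz⟩ := hf.convex.exists_mem_subdiff hrefl hf.proper hf.lsc hηU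
  have h1 := hf.add_apply_le_conj hx (interior_subset hηU)
  have h2 := hf.add_apply_le_conj hz (interior_subset hξ)
  have h3 : (η - ξ) (z - x) ≤ ‖η - ξ‖ * ‖z - x‖ := (le_abs_self _).trans ((η - ξ).le_opNorm _)
  have h4 : ‖η - ξ‖ * ‖z - x‖ ≤ ‖η - ξ‖ * c := by
    gcongr
    exact (hη z hz).le
  simp only [sub_apply, map_sub] at h3
  rw [NormedSpace.dual_def, sub_apply, Real.norm_eq_abs, abs_of_nonneg (by linarith)]
  linarith

theorem frechetDeriv_conj
    (hrefl : Function.Surjective (NormedSpace.inclusionInDoubleDual ℝ X))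
    (hf : UniformlyEssentiallyStronglyConvex f γ) {x : X} {ξ : StrongDual ℝ X}
    (hξ : ξ ∈ interior (effDom (conj f))) (hx : ξ ∈ subdiff f x) :
    frechetDeriv (conj f) ξ = NormedSpace.inclusionInDoubleDual ℝ X x :=
  (hf.hasFDerivAt_conj hrefl hξ hx).fderiv

theorem interior_effDom_conj_nonempty
    (hrefl : Function.Surjective (NormedSpace.inclusionInDoubleDual ℝ X))
    (hf : UniformlyEssentiallyStronglyConvex f γ) : (interior (effDom (conj f))).Nonempty := by
  obtain ⟨x, hx⟩ := hf.convex.domSubdiff_nonempty hrefl hf.proper hf.lsc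
  obtain ⟨ξ, hξ⟩ := hf.strong x hx
  obtain ⟨δ, hδ, hball⟩ := hf.modulus_mem.exists_ball_subset_effDom_conj hf.proper
  exact ⟨ξ, mem_interior.2 ⟨_, hball x ξ hξ, Metric.isOpen_ball, Metric.mem_ball_self hδ⟩⟩

/-- A subgradient outside the interior would generate a whole half-line of them, an unbounded set of
points sharing the subgradient `ξ` of `f`. -/
theorem subdiff_conj_eq_empty
    (hrefl : Function.Surjective (NormedSpace.inclusionInDoubleDual ℝ X))
    (hf : UniformlyEssentiallyStronglyConvex f γ) {ξ : StrongDual ℝ X}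
    (hξ : ξ ∉ interior (effDom (conj f))) : subdiff (conj f) ξ = ∅ := by
  rw [eq_empty_iff_forall_notMem]
  intro G hG
  obtain ⟨n, hn0, hn⟩ := (isConvexFn_conj f).exists_forall_add_smul_mem_subdiff hf.isProper_conj
    (hf.interior_effDom_conj_nonempty hrefl) hξ hG
  have h0 := fun x =>
    hf.convex.inclusion_mem_subdiff_conj_iff hf.proper hf.lsc (x := x) (ξ := ξ)
  obtain ⟨x, rfl⟩ := hrefl G
  obtain ⟨v, rfl⟩ := hrefl n
  obtain ⟨V, hV, hbdd⟩ := hf.locallyBounded ξ ⟨x, (h0 _).1 hG⟩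
  obtain ⟨R, hR⟩ := hbdd.exists_norm_le
  have hv : 0 < ‖v‖ := norm_pos_iff.2 fun hv => hn0 (by simp [hv])
  set t : ℝ := (|R| + ‖x‖ + 1) / ‖v‖ with ht
  have ht0 : 0 ≤ t := by positivity
  have h1 := hn t ht0
  rw [← map_smul, ← map_add] at h1
  have h2 := hR _ ⟨ξ, mem_of_mem_nhds hV, (h0 _).1 h1⟩
  have h3 : ‖t • v‖ = |R| + ‖x‖ + 1 := by
    rw [norm_smul_of_nonneg ht0, ht, div_mul_cancel₀ _ hv.ne']
  have h4 := norm_sub_le_norm_add (t • v) x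
  rw [add_comm] at h4
  have h5 := le_abs_self R
  linarith

theorem essentiallyFrechetDifferentiable_conj
    (hrefl : Function.Surjective (NormedSpace.inclusionInDoubleDual ℝ X))
    (hf : UniformlyEssentiallyStronglyConvex f γ) :
    EssentiallyFrechetDifferentiable (conj f) where
  proper := hf.isProper_conj
  convex := isConvexFn_conj f
  lsc := lowerSemicontinuous_conj f
  interior_nonempty := hf.interior_effDom_conj_nonempty hrefl
  differentiable := fun ξ hξ => by
    obtain ⟨x, hx⟩ := hf.convex.exists_mem_subdiff hrefl hf.proper hf.lsc hξ
    exact (hf.hasFDerivAt_conj hrefl hξ hx).differentiableAt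
  blowup := by
    intro u ξ hu hξ hlim
    by_contra hcon
    rw [tendsto_atTop] at hcon
    push Not at hcon
    obtain ⟨M, hM⟩ := hcon
    have hne : (subdiff (conj f) ξ).Nonempty := by
      refine (isConvexFn_conj f).subdiff_nonempty_of_tendsto hf.isProper_conj
        (lowerSemicontinuous_conj f) hlim (abs_nonneg M) (hM.mono fun j hj => ?_)
      obtain ⟨x, hx⟩ := hf.convex.exists_mem_subdiff hrefl hf.proper hf.lsc (hu j)
      rw [hf.frechetDeriv_conj hrefl (hu j) hx] at hj
      exact ⟨_, inclusion_mem_subdiff_conj_of_mem_subdiff hf.proper hx,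
        (lt_of_not_ge (by simpa using hj)).le.trans (le_abs_self M)⟩
    rw [hf.subdiff_conj_eq_empty hrefl hξ.2] at hne
    exact not_nonempty_empty hne

theorem argmaxSet_eq_singleton (hf : UniformlyEssentiallyStronglyConvex f γ) {x : X}
    {ξ : StrongDual ℝ X} (hx : ξ ∈ subdiff f x) : argmaxSet f ξ = {x} := by
  ext z
  rw [mem_argmaxSet_iff hf.proper, mem_singleton_iff]
  refine ⟨fun hz => hf.eq_of_mem_subdiff hz hx, ?_⟩
  rintro rfl
  exact hx

theorem effDom_conj_eq_univ
    (hrefl : Function.Surjective (NormedSpace.inclusionInDoubleDual ℝ X))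
    (hf : UniformlyEssentiallyStronglyConvex f γ)
    (hstrong : ∀ x₀ : X, ∀ ξ₀ ∈ subdiff f x₀, StrongLowerBound f γ x₀ ξ₀) :
    effDom (conj f) = univ := by
  obtain ⟨δ, hδ, hball⟩ := hf.modulus_mem.exists_ball_subset_effDom_conj hf.proper
  -- The radius `δ` depends on neither the point nor the subgradient, so the interior absorbs its
  -- closure.
  have hclosed : IsClosed (interior (effDom (conj f))) := by
    refine isClosed_of_closure_subset fun ξ hξ => ?_
    obtain ⟨η, hη, hdist⟩ := Metric.mem_closure_iff.1 hξ δ hδ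
    obtain ⟨x, hx⟩ := hf.convex.exists_mem_subdiff hrefl hf.proper hf.lsc hη
    exact mem_interior.2 ⟨_, hball x η (hstrong x η hx), Metric.isOpen_ball, hdist⟩
  have hclopen : IsClopen (interior (effDom (conj f))) := ⟨hclosed, isOpen_interior⟩
  exact eq_univ_of_univ_subset
    ((hclopen.eq_univ (hf.interior_effDom_conj_nonempty hrefl)).ge.trans interior_subset)

end UniformlyEssentiallyStronglyConvex

/-- Adding the two bounds, each tested at the other point, gives `2 * γ ‖x₁ - x₂‖ ≤ (ξ₁ - ξ₂) (x₁ -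
x₂)`. -/
theorem enorm_sub_le_quotInv (hp : IsProper f) {x₁ x₂ : X} {ξ₁ ξ₂ : StrongDual ℝ X}
    (h₁ : StrongLowerBound f γ x₁ ξ₁) (h₂ : StrongLowerBound f γ x₂ ξ₂) :
    ‖x₁ - x₂‖ₑ ≤ quotInv γ (‖ξ₁ - ξ₂‖ₑ / 2) := by
  refine le_iSup₂_of_le ‖x₁ - x₂‖₊ ?_ le_rfl
  refine or_iff_not_imp_left.2 fun hne => ?_
  have hpos : 0 < ‖x₁ - x₂‖ := lt_of_le_of_ne (norm_nonneg _) fun h => hne (NNReal.eq h.symm)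
  refine ENNReal.div_le_of_le_mul (ENNReal.le_of_forall_nnreal_lt fun k hk => ?_)
  have hd₁ := ((mem_subdiff_iff hp).1 h₁.mem_subdiff).1
  have hd₂ := ((mem_subdiff_iff hp).1 h₂.mem_subdiff).1
  have e1 := h₂.add_le_toReal hp hd₁ hk.le
  have e2 := h₁.add_le_toReal hp hd₂ (x := x₂) (k := k)
    (by rw [← neg_sub, nnnorm_neg]; exact hk.le)
  have e3 : (ξ₁ - ξ₂) (x₁ - x₂) ≤ ‖ξ₁ - ξ₂‖ * ‖x₁ - x₂‖ :=
    (le_abs_self _).trans ((ξ₁ - ξ₂).le_opNorm _)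
  simp only [sub_apply, map_sub] at e1 e2 e3
  have e4 : (k : ℝ) ≤ ‖ξ₁ - ξ₂‖ / 2 * ‖x₁ - x₂‖ := by linarith
  have e5 : k ≤ ‖ξ₁ - ξ₂‖₊ / 2 * ‖x₁ - x₂‖₊ := by exact_mod_cast e4
  have e6 : (k : ℝ≥0∞) ≤ ((‖ξ₁ - ξ₂‖₊ / 2 * ‖x₁ - x₂‖₊ : ℝ≥0) : ℝ≥0∞) := by exact_mod_cast e5
  rw [ENNReal.coe_mul, ENNReal.coe_div two_ne_zero] at e6
  exact e6

/-- Conjugation reverses the inequality, and `‖x - x₀‖ * ‖ξ - ξ₀‖ - γ ‖x - x₀‖` is at most `γ* ‖ξ -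
ξ₀‖`. -/
theorem StrongLowerBound.smoothUpperBound_conj (hp : IsProper f)
    (h : StrongLowerBound f γ x₀ ξ₀) :
    SmoothUpperBound (conj f) (gamConj γ) ξ₀ (NormedSpace.inclusionInDoubleDual ℝ X x₀) := by
  intro ξ
  have hx₀ := ((mem_subdiff_iff hp).1 h.mem_subdiff).1
  rw [NormedSpace.dual_def]
  induction hC : gamConj γ ‖ξ - ξ₀‖₊ with
  | top =>
    rw [EReal.coe_ennreal_top, EReal.add_top_of_ne_bot]
    · exact le_top
    · simp [EReal.add_eq_bot_iff, conj_ne_bot hp, -EReal.coe_sub]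
  | coe C =>
    have hC' : ((C : ℝ≥0∞) : EReal) = ((C : ℝ) : EReal) := rfl
    refine le_trans ?_ (add_le_add_left (add_le_add_left (le_conj hp hx₀ ξ₀) _) _)
    rw [hC', ← EReal.coe_add, ← EReal.coe_add, conj_le_coe_iff]
    intro x
    have h1 : (ξ - ξ₀) (x - x₀) ≤ ‖ξ - ξ₀‖ * ‖x - x₀‖ :=
      (le_abs_self _).trans ((ξ - ξ₀).le_opNorm _)
    -- A finite substitute for `γ ‖x - x₀‖`, which may be infinite; truncation at `0` is harmless as
    -- `γ ≥ 0`.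
    set k : ℝ≥0 := ‖x - x₀‖₊ * ‖ξ - ξ₀‖₊ - C with hk
    have hkγ : (k : ℝ≥0∞) ≤ γ ‖x - x₀‖₊ := by
      have h2 : (‖x - x₀‖₊ : ℝ≥0∞) * ‖ξ - ξ₀‖₊ - γ ‖x - x₀‖₊ ≤ C := by
        rw [← hC]
        exact le_iSup (fun r : ℝ≥0 => (r : ℝ≥0∞) * ‖ξ - ξ₀‖₊ - γ r) ‖x - x₀‖₊
      rw [hk, ENNReal.coe_sub, ENNReal.coe_mul, tsub_le_iff_left]
      rwa [tsub_le_iff_right] at h2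
    have h3 : ‖x - x₀‖ * ‖ξ - ξ₀‖ - C ≤ k := by
      have : ‖x - x₀‖₊ * ‖ξ - ξ₀‖₊ ≤ k + C := le_tsub_add
      have : ‖x - x₀‖ * ‖ξ - ξ₀‖ ≤ k + C := by exact_mod_cast this
      linarith
    refine le_trans ?_ (h.add_coe_le hp hkγ)
    rw [EReal.coe_le_coe_iff]
    simp only [sub_apply, map_sub] at h1 ⊢
    linarith

end StrongConvexity

end BanachDuality

open BanachDuality in
theorem theorem1 {X : Type*} [NormedAddCommGroup X] [NormedSpace ℝ X] [CompleteSpace X]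
    (hrefl : Function.Surjective (NormedSpace.inclusionInDoubleDual ℝ X))
    (f : X → EReal) (γ : ℝ≥0 → ℝ≥0∞)
    (hf : UniformlyEssentiallyStronglyConvex f γ) :
    -- the conjugate is proper and essentially Fréchet differentiable, and its derivative is
    -- the unique maximizer
    (IsProper (conj f) ∧ EssentiallyFrechetDifferentiable (conj f) ∧
      ∀ ξ ∈ interior (effDom (conj f)), ∃ x : X, argmaxSet f ξ = {x} ∧
        frechetDeriv (conj f) ξ = NormedSpace.inclusionInDoubleDual ℝ X x) ∧
    -- the quantitative claims, where the modulus serves every subgradient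
    ((∀ x₀ : X, ∀ ξ₀ ∈ subdiff f x₀, StrongLowerBound f γ x₀ ξ₀) →
      effDom (conj f) = univ ∧
      (StrictMonoOn (quot γ) (Ioi 0) →
        (∀ ξ₁ ξ₂ : StrongDual ℝ X,
          ‖frechetDeriv (conj f) ξ₁ - frechetDeriv (conj f) ξ₂‖ₑ
            ≤ quotInv γ (‖ξ₁ - ξ₂‖ₑ / 2)) ∧
        Monotone (fun r : ℝ≥0∞ => quotInv γ (r / 2)) ∧
        Tendsto (fun r : ℝ≥0∞ => quotInv γ (r / 2)) (𝓝 0) (𝓝 0) ∧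
        UniformContinuous (frechetDeriv (conj f))) ∧
      UniformlyEssentiallyStronglySmooth (conj f) (gamConj γ)) := by
  have hess := hf.essentiallyFrechetDifferentiable_conj hrefl
  refine ⟨⟨hf.isProper_conj, hess, fun ξ hξ => ?_⟩, fun hstrong => ?_⟩
  · obtain ⟨x, hx⟩ := hf.convex.exists_mem_subdiff hrefl hf.proper hf.lsc hξ
    exact ⟨x, hf.argmaxSet_eq_singleton hx, hf.frechetDeriv_conj hrefl hξ hx⟩
  have hdom := hf.effDom_conj_eq_univ hrefl hstrong
  have hint : ∀ ξ, ξ ∈ interior (effDom (conj f)) := by simp [hdom]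
  have hex : ∀ ξ, ∃ x, ξ ∈ subdiff f x := fun ξ =>
    hf.convex.exists_mem_subdiff hrefl hf.proper hf.lsc (hint ξ)
  refine ⟨hdom, fun hmono => ?_, hess.proper, hess.differentiable,
    hf.modulus_mem.gamL_gamConj, fun ξ _ => ?_⟩
  · have hle : ∀ ξ₁ ξ₂ : StrongDual ℝ X,
        ‖frechetDeriv (conj f) ξ₁ - frechetDeriv (conj f) ξ₂‖ₑ ≤
          quotInv γ (‖ξ₁ - ξ₂‖ₑ / 2) := by
      intro ξ₁ ξ₂
      obtain ⟨x₁, h₁⟩ := hex ξ₁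
      obtain ⟨x₂, h₂⟩ := hex ξ₂
      rw [hf.frechetDeriv_conj hrefl (hint ξ₁) h₁, hf.frechetDeriv_conj hrefl (hint ξ₂) h₂,
        ← map_sub]
      refine le_trans ?_ (enorm_sub_le_quotInv hf.proper (hstrong x₁ ξ₁ h₁) (hstrong x₂ ξ₂ h₂))
      exact enorm_le_iff_norm_le.2 (NormedSpace.double_dual_bound ℝ X _)
    have hlim := tendsto_quotInv_div_two hf.modulus_mem hmono
    refine ⟨hle, fun r s hrs => quotInv_mono (ENNReal.div_le_div_right hrs 2), hlim, ?_⟩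
    rw [EMetric.uniformContinuous_iff]
    intro ε hε
    obtain ⟨δ, hδ, hball⟩ := ENNReal.nhds_zero_basis.mem_iff.1 (hlim.eventually_lt_const hε)
    refine ⟨δ, hδ, fun {ξ₁ ξ₂} hd => ?_⟩
    rw [edist_eq_enorm_sub] at hd ⊢
    exact (hle ξ₁ ξ₂).trans_lt (hball hd)
  · obtain ⟨x, hx⟩ := hex ξ
    exact ⟨_, (hstrong x ξ hx).smoothUpperBound_conj hf.proper⟩
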